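/- **Theorem 5.3.** Let $d\ge 1$, $\varepsilon>0$, $A\in\mathbb R^{d\times d}$, $F\in C^3(\mathbb R^d,\mathbb R^d)$, $m_0\in\mathbb R^d$, and let $\Sigma_{\mathrm{pr}}\in\mathbb R^{d\times d}$ be symmetric positive definite. For $\tau\ge 0$ let $G_\tau(x)=Ax+\tau F(x)$, let $y_\tau\in\mathbb R^d$ be data, and let $\mu^{y_\tau}$ be the posterior distribution for the prior $\mu=\mathcal N(m_0,\Sigma_{\mathrm{pr}})$, i.e. the probability measure $$\mu^{y_\tau}(\mathrm dx)\propto\exp\Big(-\tfrac1{2\varepsilon}|y_\tau-G_\tau(x)|^2\Big)\,\mu(\mathrm dx).$$ For a positive definite matrix $S$ write $\|h\|_S=(h^{\mathsf T}S^{-1}h)^{1/2}$ and $\|D^jF(x)\|_S=\sup\{|D^jF(x)(h_1,\dots,h_j)| : \|h_1\|_S,\dots,\|h_j\|_S\le 1\}$, where $|\cdot|$ is the Euclidean norm (so $\|D^0F(x)\|_S=|F(x)|$); $\|\cdot\|$ without index is the Euclidean operator norm of a matrix. Assume that there is $\tau_0>0$ with the following properties. 1. For every $\tau\in[0,\tau_0]$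 the function $$I_\tau(x)=\tfrac12|Ax+\tau F(x)-y_\tau|^2+\tfrac\varepsilon2\|x-m_0\|_{\Sigma_{\mathrm{pr}}}^2+c_\tau$$ has a unique global minimizer $\hat x_\tau$ (the constant $c_\tau$ being chosen such that $I_\tau(\hat x_\tau)=0$), and $D^2I_\tau(\hat x_\tau)$ is positive definite. Put $\Sigma_\tau:=D^2I_\tau(\hat x_\tau)^{-1}$. As $\tau\downarrow0$, the vectors $y_\tau$ and $\hat x_\tau$ converge in $\mathbb R^d$, and $\Sigma_\tau$ converges to a positive definite matrix. 2. There are constants $C_0,C_1,C_2,C_3>0$ such that $\|D^jF(x)\|_{\Sigma_\tau}\le C_j$ for $j=0,1,2,3$, all $x\in\mathbb R^d$ and all $\tau\in[0,\tau_0]$, and there is $M>0$ such that $D^3F(x)=0$ whenever $|x|>M$. Let $\mathcal L_{\mu^{y_\tau}}=\mathcal N(\hat x_\tau,\varepsilon\Sigma_\tau)$ be the Laplace approximation of $\mu^{y_\tau}$, and let $d_{\mathrm{TV}}(\nu,\mu)=\sup_B|\nu(B)-\mu(B)|$, the supremum being over all Borel sets $B$. Set $$C=\tfrac23\sqrt2\,e\,\frac{\Gamma(\frac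 d2+\frac32)}{\Gamma(\frac d2)},\qquad V(\tau)=C_3\big(\|A\|M+|y_\tau|\big)+3C_2\big\|A\Sigma_\tau^{1/2}\big\|,\qquad W=C_3C_0+3C_2C_1 .$$ Then there exists $\tau_1\in(0,\tau_0]$ such that $$d_{\mathrm{TV}}\big(\mu^{y_\tau},\mathcal L_{\mu^{y_\tau}}\big)\le C(1+\varepsilon)\varepsilon^{1/2}\Big(V(\tau)\tau+\frac W2\tau^2\Big)\qquad\text{for all }\tau\in[0,\tau_1],$$ and $\{V(\tau)\}_{\tau\in[0,\tau_1]}$ is bounded. Consequently there is a constant $L$ such that $d_{\mathrm{TV}}(\mu^{y_\tau},\mathcal L_{\mu^{y_\tau}})\le L\tau$ for all $\tau\in[0,\tau_1]$. -/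

import Mathlib

open MeasureTheory ProbabilityTheory Set Filter Topology

noncomputable section

namespace LaplaceApprox

open scoped Matrix MatrixOrder

/-- The Euclidean space of dimension `d`. -/
abbrev Vec (d : ℕ) : Type := EuclideanSpace ℝ (Fin d)

/-- The total variation distance `sup_A |ν(A) - μ(A)|` over all measurable sets `A`. -/
def tvDist {α : Type*} [MeasurableSpace α] (ν μ : Measure α) : ℝ :=
  ⨆ A : {A : Set α // MeasurableSet A}, |ν.real A - μ.real A|

/-- `x` is the unique global minimizer of `f`. -/
def IsUniqueMinimizer {α : Type*} (f : α → ℝ) (x : α) : Prop :=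
  ∀ z, z ≠ x → f x < f z

/-- The Hessian matrix `(D²f(x)(e_j, e_k))_{j,k}`. -/
def hessian {d : ℕ} (f : Vec d → ℝ) (x : Vec d) : Matrix (Fin d) (Fin d) ℝ :=
  Matrix.of fun j k =>
    iteratedFDeriv ℝ 2 f x ![EuclideanSpace.single j 1, EuclideanSpace.single k 1]

/-- The norm `‖h‖_S = |S^{-1/2} h| = (hᵀ S⁻¹ h)^{1/2}` for a positive definite matrix `S`. -/
def wnorm {d : ℕ} (S : Matrix (Fin d) (Fin d) ℝ) (h : Vec d) : ℝ :=
  √(h.ofLp ⬝ᵥ (S⁻¹ *ᵥ h.ofLp))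

/-- `‖D^j F(x)‖_S`: the supremum of `|D^j F(x)(h_1, …, h_j)|` over all `h_i` with
`‖h_i‖_S ≤ 1`. For `j = 0` this is `|F(x)|`. -/
def diffNorm {d : ℕ} (S : Matrix (Fin d) (Fin d) ℝ) (j : ℕ) (F : Vec d → Vec d) (x : Vec d) : ℝ :=
  sSup {r : ℝ | ∃ h : Fin j → Vec d, (∀ i, wnorm S (h i) ≤ 1) ∧ r = ‖iteratedFDeriv ℝ j F x h‖}

/-- The operator norm of a matrix with respect to the Euclidean norm. -/
def opNorm {d : ℕ} (A : Matrix (Fin d) (Fin d) ℝ) : ℝ :=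
  ‖Matrix.toEuclideanCLM (𝕜 := ℝ) A‖

/-- The positive semidefinite square root `S^{1/2}` of a positive semidefinite matrix. -/
def matSqrt {d : ℕ} (S : Matrix (Fin d) (Fin d) ℝ) : Matrix (Fin d) (Fin d) ℝ :=
  CFC.sqrt S

/-- The scaled negative log-likelihood `Φ(x) = |y - G(x)|² / 2`. -/
def misfit {d : ℕ} (G : Vec d → Vec d) (y : Vec d) (x : Vec d) : ℝ :=
  1 / 2 * ‖y - G x‖ ^ 2

/-- The negative log-density `R` of the Gaussian distribution `N(m, S)`. -/
def gaussianNegLogDensity {d : ℕ} (m : Vec d) (S : Matrix (Fin d) (Fin d) ℝ) (x : Vec d) : ℝ :=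
  1 / 2 * wnorm S (x - m) ^ 2 + (d : ℝ) / 2 * Real.log (2 * Real.pi) + 1 / 2 * Real.log S.det

/-- The function `I(x) = Φ(x) + ε R(x) - Φ(x̂) - ε R(x̂)`. -/
def potential {d : ℕ} (ε : ℝ) (Φ R : Vec d → ℝ) (xhat : Vec d) (x : Vec d) : ℝ :=
  Φ x + ε * R x - Φ xhat - ε * R xhat

/-- The posterior distribution: the probability measure with density proportional to
`exp(-Φ(x)/ε)` with respect to the prior. -/
def posterior {d : ℕ} (ε : ℝ) (Φ : Vec d → ℝ) (prior : Measure (Vec d)) : Measure (Vec d) :=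
  prior.tilted fun x => -(1 / ε) * Φ x

/-- The Laplace approximation `N(x̂, ε Σ)` with `Σ = D²I(x̂)⁻¹`. -/
def laplace {d : ℕ} (ε : ℝ) (I : Vec d → ℝ) (xhat : Vec d) : Measure (Vec d) :=
  multivariateGaussian xhat (ε • (hessian I xhat)⁻¹)

/-- The perturbed linear forward mapping `G_τ(x) = A x + τ F(x)`. -/
def perturbedMap {d : ℕ} (A : Matrix (Fin d) (Fin d) ℝ) (F : Vec d → Vec d) (τ : ℝ) (x : Vec d) :
    Vec d :=
  Matrix.toEuclideanLin A x + τ • F x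

/-- The function `I_τ` for the forward mapping `G_τ`, the prior `N(m₀, S₀)`, the data `y`
and the MAP estimate `xhat`. -/
def perturbedPotential {d : ℕ} (ε : ℝ) (A : Matrix (Fin d) (Fin d) ℝ) (F : Vec d → Vec d)
    (m₀ : Vec d) (S₀ : Matrix (Fin d) (Fin d) ℝ) (τ : ℝ) (y xhat : Vec d) : Vec d → ℝ :=
  potential ε (misfit (perturbedMap A F τ) y) (gaussianNegLogDensity m₀ S₀) xhat

/-- The posterior distribution for the forward mapping `G_τ`, the prior `N(m₀, S₀)` and
the data `y`. -/
def perturbedPosterior {d : ℕ} (ε : ℝ) (A : Matrix (Fin d) (Fin d) ℝ) (F : Vec d → Vec d)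
    (m₀ : Vec d) (S₀ : Matrix (Fin d) (Fin d) ℝ) (τ : ℝ) (y : Vec d) : Measure (Vec d) :=
  posterior ε (misfit (perturbedMap A F τ) y) (multivariateGaussian m₀ S₀)

/-- The constant `C = (2/3) √2 e Γ(d/2 + 3/2) / Γ(d/2)`. -/
def constC (d : ℕ) : ℝ :=
  2 / 3 * √2 * Real.exp 1 * (Real.Gamma ((d : ℝ) / 2 + 3 / 2) / Real.Gamma ((d : ℝ) / 2))

/-- `V = C₃ (‖A‖ M + |y|) + 3 C₂ ‖A S^{1/2}‖`. -/
def constV {d : ℕ} (C₂ C₃ M : ℝ) (A S : Matrix (Fin d) (Fin d) ℝ) (y : Vec d) : ℝ :=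
  C₃ * (opNorm A * M + ‖y‖) + 3 * C₂ * opNorm (A * matSqrt S)

/-- `W = C₃ C₀ + 3 C₂ C₁`. -/
def constW (C₀ C₁ C₂ C₃ : ℝ) : ℝ :=
  C₃ * C₀ + 3 * C₂ * C₁

end LaplaceApprox

end

open LaplaceApprox

noncomputable section

namespace LaplaceApprox

open scoped Matrix MatrixOrder

variable {d : ℕ}

/-! ### Exponential tilting -/

/-! Write `I_τ(x̂+v) = ½‖v‖² + R(v)`, with `‖·‖` the norm weighted by `Σ_τ`. The posterior is then
the Laplace approximation tilted by `-R/ε`, so everything reduces to showing that `R` is small and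
that a small tilt moves a Gaussian little.

The prior term and `|Ax - y|²` are quadratic, so a third derivative of `I_τ` along a line involves
only `⟨g, τF'''⟩ + 3⟨g', τF''⟩`, where `g = Ax - y + τF`. This is at most `(Vτ + Wτ²)‖v‖³`; the
cutoff `M` of `D³F` keeps `|Ax|` bounded wherever the first term is nonzero. Taylor's formula gives
`|R| ≤ k‖v‖³` with `k = (Vτ + Wτ²)/6` (`abs_remainder_le_cube`).

A cubic bound alone does not make `exp(|R|/ε)` integrable against a Gaussian. Since `F` is bounded,
`R` also satisfies `|R| ≤ η‖v‖²` with `η = O(τ)` (`abs_remainder_le_sq`). From `|eˣ - 1| ≤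
|x|e^|x|`, with the cubic bound in the factor and the quadratic one in the exponent, the `L¹`
distance of the density from 1 is controlled by the explicit moment `E[|Z|³ exp(η|Z|²)]`. For small
`τ` the inflation caused by `η` and by normalisation fits into the gap between `96/19` and `2e`,
which is where the `e` in the constant is used.

Gaussians are handled throughout as normalised tilts of Lebesgue measure, so determinants and
normalising constants drop out. -/

lemma tilted_add_const {α : Type*} [MeasurableSpace α] (μ : Measure α) (f : α → ℝ) (c : ℝ) :
    μ.tilted (fun x => f x + c) = μ.tilted f := by
  unfold Measure.tilted
  congr 1
  ext x
  simp_rw [Real.exp_add, integral_mul_const]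
  rw [mul_div_mul_right _ _ (Real.exp_pos c).ne']

/-- Normalisation absorbs constant factors of the reference measure; this disposes of the Jacobian
of an affine change of variables. -/
lemma tilted_smul_measure {α : Type*} [MeasurableSpace α] (μ : Measure α) (f : α → ℝ)
    {c : ℝ} (hc : 0 < c) : (ENNReal.ofReal c • μ).tilted f = μ.tilted f := by
  unfold Measure.tilted
  rw [withDensity_smul_measure, integral_smul_measure, ENNReal.toReal_ofReal hc.le]
  ext s hs
  rw [Measure.smul_apply, withDensity_apply _ hs, withDensity_apply _ hs, smul_eq_mul,
    ← lintegral_const_mul' _ _ ENNReal.ofReal_ne_top]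
  congr 1
  ext x
  rw [← ENNReal.ofReal_mul hc.le, smul_eq_mul]
  congr 1
  field_simp

lemma map_tilted {α β : Type*} [MeasurableSpace α] [MeasurableSpace β] (μ : Measure α)
    (e : α → β) (he : MeasurableEmbedding e) (f : β → ℝ) :
    (μ.tilted (f ∘ e)).map e = (μ.map e).tilted f := by
  ext s hs
  rw [he.map_apply, tilted_apply' _ _ hs, tilted_apply' _ _ (he.measurable hs),
    he.restrict_map, he.lintegral_map, he.integral_map]
  rfl

lemma stdGaussian_eq_tilted (d : ℕ) :
    stdGaussian (Vec d) = (volume : Measure (Vec d)).tilted fun z => -(1 / 2) * ‖z‖ ^ 2 := by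
  have hint : Integrable (fun z : Vec d => Real.exp (-(1 / 2) * ‖z‖ ^ 2)) := by
    have := (GaussianFourier.integrable_cexp_neg_mul_sq_norm_add (V := Vec d)
      (b := (1 / 2 : ℂ)) (by norm_num) 0 0).re
    refine this.congr (ae_of_all _ fun z => ?_)
    simp only [zero_mul, add_zero, RCLike.re_to_complex]
    rw [← Complex.exp_ofReal_re]
    push_cast
    rfl
  have := isProbabilityMeasure_tilted hint
  -- The characteristic function of the tilted measure is a Gaussian Fourier integral, known in
  -- closed form.
  apply Measure.ext_of_charFun
  ext t
  rw [charFun_stdGaussian, charFun_apply, integral_tilted]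
  rw [GaussianFourier.integral_rexp_neg_mul_sq_norm (by norm_num : (0 : ℝ) < 1 / 2)]
  set Z : ℝ := (Real.pi / (1 / 2)) ^ (Module.finrank ℝ (Vec d) / 2 : ℝ) with hZ
  have hZ0 : 0 < Z := by positivity
  have h1 : ∀ z : Vec d, (Real.exp (-(1 / 2) * ‖z‖ ^ 2) / Z) •
      Complex.exp ((inner ℝ z t : ℝ) * Complex.I) =
      (Z : ℂ)⁻¹ * Complex.exp (-(1 / 2 : ℂ) * ‖z‖ ^ 2 + Complex.I * (inner ℝ t z : ℝ)) := by
    intro z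
    rw [Complex.real_smul, Complex.exp_add, real_inner_comm]
    push_cast
    ring_nf
  simp_rw [h1]
  rw [integral_const_mul, GaussianFourier.integral_cexp_neg_mul_sq_norm_add (by norm_num)]
  have h2 : ((Real.pi : ℂ) / (1 / 2)) ^ ((Module.finrank ℝ (Vec d) : ℂ) / 2) = (Z : ℂ) := by
    rw [hZ, Complex.ofReal_cpow (by positivity)]
    push_cast
    rfl
  rw [h2, ← mul_assoc, inv_mul_cancel₀ (by exact_mod_cast hZ0.ne'), one_mul]
  congr 1
  rw [Complex.I_sq]
  ring

/-! ### The square root of a positive definite matrix and the associated norm -/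

/-- The linear map `z ↦ S^{1/2} z`. -/
def sqrtMap (S : Matrix (Fin d) (Fin d) ℝ) : Vec d →L[ℝ] Vec d :=
  Matrix.toEuclideanCLM (𝕜 := ℝ) (CFC.sqrt S)

lemma sqrt_mul_inv_mul_sqrt {S : Matrix (Fin d) (Fin d) ℝ} (hS : S.PosDef) :
    CFC.sqrt S * S⁻¹ * CFC.sqrt S = 1 := by
  have h : CFC.sqrt S * CFC.sqrt S = S := CFC.sqrt_mul_sqrt_self S hS.posSemidef.nonneg
  have hdet : IsUnit S.det := hS.det_pos.ne'.isUnit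
  have hq : IsUnit (CFC.sqrt S).det := by
    rw [← h, Matrix.det_mul] at hdet
    exact isUnit_of_mul_isUnit_left hdet
  conv_lhs => rw [← h]
  rw [CFC.sqrt_mul_sqrt_self S hS.posSemidef.nonneg]
  conv_lhs => enter [1, 2]; rw [← h]
  rw [Matrix.mul_inv_rev, ← mul_assoc, Matrix.mul_nonsing_inv _ hq, one_mul,
    Matrix.nonsing_inv_mul _ hq]

/-- `S^{1/2}` is an isometry from the Euclidean to the weighted norm. Being surjective as well, it
transfers Euclidean facts to `wnorm S`. -/
lemma wnorm_sqrtMap {S : Matrix (Fin d) (Fin d) ℝ} (hS : S.PosDef) (z : Vec d) :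
    wnorm S (sqrtMap S z) = ‖z‖ := by
  have hsym : (CFC.sqrt S)ᵀ = CFC.sqrt S := by
    have := (CFC.sqrt_nonneg S).isSelfAdjoint.star_eq
    rwa [Matrix.star_eq_conjTranspose, Matrix.conjTranspose_eq_transpose_of_trivial] at this
  have : (sqrtMap S z).ofLp = CFC.sqrt S *ᵥ z.ofLp := Matrix.ofLp_toEuclideanCLM _ _
  rw [wnorm, this, Matrix.mulVec_mulVec, ← Matrix.vecMul_transpose, hsym,
    ← Matrix.dotProduct_mulVec, Matrix.mulVec_mulVec, ← mul_assoc, sqrt_mul_inv_mul_sqrt hS,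
    Matrix.one_mulVec, EuclideanSpace.norm_eq]
  congr 1
  simp [dotProduct, sq]

lemma sqrtMap_injective {S : Matrix (Fin d) (Fin d) ℝ} (hS : S.PosDef) :
    Function.Injective (sqrtMap S) := by
  rw [injective_iff_map_eq_zero]
  intro z hz
  have := wnorm_sqrtMap hS z
  rw [hz] at this
  simpa [wnorm] using this.symm

lemma sqrtMap_surjective {S : Matrix (Fin d) (Fin d) ℝ} (hS : S.PosDef) :
    Function.Surjective (sqrtMap S) :=
  LinearMap.injective_iff_surjective (f := (sqrtMap S : Vec d →ₗ[ℝ] Vec d)).1 (sqrtMap_injective hS)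

lemma wnorm_nonneg (S : Matrix (Fin d) (Fin d) ℝ) (h : Vec d) : 0 ≤ wnorm S h := Real.sqrt_nonneg _

lemma wnorm_smul (S : Matrix (Fin d) (Fin d) ℝ) (t : ℝ) (h : Vec d) :
    wnorm S (t • h) = |t| * wnorm S h := by
  rw [wnorm, wnorm, ← Real.sqrt_sq_eq_abs, ← Real.sqrt_mul (sq_nonneg t)]
  congr 1
  simp [Matrix.mulVec_smul, sq, mul_assoc]

lemma wnorm_eq_zero {S : Matrix (Fin d) (Fin d) ℝ} (hS : S.PosDef) {h : Vec d}
    (h0 : wnorm S h = 0) : h = 0 := by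
  obtain ⟨z, rfl⟩ := sqrtMap_surjective hS h
  rw [wnorm_sqrtMap hS, norm_eq_zero] at h0
  simp [h0]

lemma continuous_wnorm (S : Matrix (Fin d) (Fin d) ℝ) : Continuous (wnorm S) := by
  unfold wnorm
  simp only [dotProduct, Matrix.mulVec]
  fun_prop

lemma wnorm_scaled_sq (S : Matrix (Fin d) (Fin d) ℝ) {ε : ℝ} (hε : 0 < ε)
    (hS : S.PosDef) (h : Vec d) : wnorm (ε • S) h ^ 2 = 1 / ε * wnorm S h ^ 2 := by
  have hpos : (ε • S).PosDef := hS.smul hε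
  have hdet : IsUnit S.det := hS.det_pos.ne'.isUnit
  have hinv : (ε • S)⁻¹ = (1 / ε) • S⁻¹ := by
    apply Matrix.inv_eq_right_inv
    rw [Matrix.smul_mul, Matrix.mul_smul, Matrix.mul_nonsing_inv _ hdet, smul_smul,
      mul_one_div_cancel hε.ne', one_smul]
  have key : wnorm (ε • S) h = √(1 / ε) * wnorm S h := by
    rw [wnorm, wnorm, hinv, ← Real.sqrt_mul (by positivity), Matrix.smul_mulVec,
      dotProduct_smul, smul_eq_mul]
  rw [key, mul_pow, Real.sq_sqrt (by positivity)]

/-! ### Lebesgue densities of Gaussian measures -/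

lemma multivariateGaussian_eq_tilted (m : Vec d) {S : Matrix (Fin d) (Fin d) ℝ} (hS : S.PosDef) :
    multivariateGaussian m S =
      (volume : Measure (Vec d)).tilted fun x => -(1 / 2) * wnorm S (x - m) ^ 2 := by
  have hdet : LinearMap.det (sqrtMap S : Vec d →ₗ[ℝ] Vec d) ≠ 0 := by
    intro h
    have := LinearMap.bot_lt_ker_of_det_eq_zero h
    rw [LinearMap.ker_eq_bot.2 (sqrtMap_injective hS)] at this
    exact lt_irrefl _ this
  let e : Vec d → Vec d := fun z => m + sqrtMap S z
  have hinj : Function.Injective e := fun a b hab => sqrtMap_injective hS (add_left_cancel hab)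
  have he : MeasurableEmbedding e :=
    Continuous.measurableEmbedding (by fun_prop) hinj
  have hvol : (volume : Measure (Vec d)).map e =
      ENNReal.ofReal |(LinearMap.det (sqrtMap S : Vec d →ₗ[ℝ] Vec d))⁻¹| • volume := by
    have h1 : e = (fun x => m + x) ∘ (sqrtMap S : Vec d →ₗ[ℝ] Vec d) := rfl
    rw [h1, ← Measure.map_map (g := fun x => m + x) (by fun_prop)
        (LinearMap.continuous_of_finiteDimensional _).measurable,
      Measure.map_linearMap_addHaar_eq_smul_addHaar _ hdet, Measure.map_smul,
      (measurePreserving_add_left volume m).map_eq]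
  have h2 : multivariateGaussian m S = (stdGaussian (Vec d)).map e := rfl
  have h3 : (fun z : Vec d => -(1 / 2) * ‖z‖ ^ 2) =
      (fun x => -(1 / 2) * wnorm S (x - m) ^ 2) ∘ e := by
    ext z
    simp [e, wnorm_sqrtMap hS]
  rw [h2, stdGaussian_eq_tilted, h3, map_tilted _ _ he, hvol,
    tilted_smul_measure _ _ (by positivity)]

lemma integrable_exp_wnorm (m : Vec d) {S : Matrix (Fin d) (Fin d) ℝ} (hS : S.PosDef) :
    Integrable fun x => Real.exp (-(1 / 2) * wnorm S (x - m) ^ 2) := by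
  by_contra h
  have h1 := multivariateGaussian_eq_tilted m hS
  -- A tilt by a non-integrable exponential is the zero measure by convention, whereas the Gaussian
  -- has mass one.
  rw [tilted_of_not_integrable h] at h1
  exact IsProbabilityMeasure.ne_zero (multivariateGaussian m S) h1

/-! ### Moments of the standard Gaussian distribution -/

lemma integral_pow_mul_exp_neg_mul_sq (n : ℕ) {b : ℝ} (hb : 0 < b) :
    ∫ y in Ioi (0 : ℝ), y ^ n * Real.exp (-b * y ^ 2) =
      b ^ (-((n : ℝ) + 1) / 2) * (1 / 2) * Real.Gamma (((n : ℝ) + 1) / 2) := by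
  have h := integral_rpow_mul_exp_neg_mul_rpow (p := 2) (q := n) (b := b) (by norm_num)
    (by have : (0 : ℝ) ≤ n := n.cast_nonneg; linarith) hb
  simpa using h

lemma integrableOn_pow_mul_exp_neg_mul_sq (n : ℕ) {b : ℝ} (hb : 0 < b) :
    IntegrableOn (fun y : ℝ => y ^ n * Real.exp (-b * y ^ 2)) (Ioi 0) := by
  have h := integrable_rpow_mul_exp_neg_mul_sq hb (s := n)
    (by have : (0 : ℝ) ≤ n := n.cast_nonneg; linarith)
  simpa using h.integrableOn

lemma integral_norm_pow_mul_exp (hd : 0 < d) (n : ℕ) {b : ℝ} (hb : 0 < b) :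
    ∫ z : Vec d, ‖z‖ ^ n * Real.exp (-b * ‖z‖ ^ 2) =
      d * volume.real (Metric.ball (0 : Vec d) 1) *
        (b ^ (-((d : ℝ) + n) / 2) * (1 / 2) * Real.Gamma (((d : ℝ) + n) / 2)) := by
  have : Nonempty (Fin d) := ⟨⟨0, hd⟩⟩
  have h := integral_fun_norm_addHaar (volume : Measure (Vec d))
    (fun y => y ^ n * Real.exp (-b * y ^ 2))
  rw [h]
  have h2 : ∀ y : ℝ, y ^ (d - 1) • (y ^ n * Real.exp (-b * y ^ 2)) =
      y ^ (d - 1 + n) * Real.exp (-b * y ^ 2) := by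
    intro y
    rw [pow_add, smul_eq_mul, mul_assoc]
  rw [finrank_euclideanSpace_fin]
  simp_rw [h2]
  rw [integral_pow_mul_exp_neg_mul_sq _ hb]
  have h3 : ((d - 1 + n : ℕ) : ℝ) + 1 = d + n := by
    have : d - 1 + n + 1 = d + n := by omega
    exact_mod_cast this
  rw [h3, nsmul_eq_mul, smul_eq_mul]
  ring

lemma integrable_norm_pow_mul_exp (hd : 0 < d) (n : ℕ) {b : ℝ} (hb : 0 < b) :
    Integrable fun z : Vec d => ‖z‖ ^ n * Real.exp (-b * ‖z‖ ^ 2) := by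
  have : Nonempty (Fin d) := ⟨⟨0, hd⟩⟩
  refine (integrable_fun_norm_addHaar (volume : Measure (Vec d))
    (f := fun y => y ^ n * Real.exp (-b * y ^ 2))).2 ?_
  rw [finrank_euclideanSpace_fin]
  refine (integrableOn_pow_mul_exp_neg_mul_sq (d - 1 + n) hb).congr_fun (fun y _ => ?_)
    measurableSet_Ioi
  simp only [smul_eq_mul]
  rw [pow_add, mul_assoc]

lemma exp_mul_norm_pow_mul_exp (n : ℕ) (η : ℝ) (z : Vec d) :
    Real.exp (-(1 / 2) * ‖z‖ ^ 2) * (‖z‖ ^ n * Real.exp (η * ‖z‖ ^ 2)) =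
      ‖z‖ ^ n * Real.exp (-(1 / 2 - η) * ‖z‖ ^ 2) := by
  rw [mul_left_comm, ← Real.exp_add]
  ring_nf

lemma integrable_stdGaussian_norm_pow_mul_exp (hd : 0 < d) (n : ℕ) {η : ℝ} (hη : η < 1 / 2) :
    Integrable (fun z => ‖z‖ ^ n * Real.exp (η * ‖z‖ ^ 2)) (stdGaussian (Vec d)) := by
  have h0 : Integrable (fun z : Vec d => Real.exp (-(1 / 2) * ‖z‖ ^ 2)) := by
    simpa using integrable_norm_pow_mul_exp hd 0 (by norm_num : (0 : ℝ) < 1 / 2)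
  rw [stdGaussian_eq_tilted, integrable_tilted_iff h0]
  simp_rw [smul_eq_mul, exp_mul_norm_pow_mul_exp]
  exact integrable_norm_pow_mul_exp hd n (by linarith)

/-- The third exponential moment of a standard Gaussian random vector. -/
lemma integral_stdGaussian_norm_cube_mul_exp (hd : 0 < d) {η : ℝ} (hη : η < 1 / 2) :
    ∫ z, ‖z‖ ^ 3 * Real.exp (η * ‖z‖ ^ 2) ∂(stdGaussian (Vec d)) =
      (1 - 2 * η) ^ (-((d : ℝ) + 3) / 2) * (2 * √2 *
        (Real.Gamma ((d : ℝ) / 2 + 3 / 2) / Real.Gamma ((d : ℝ) / 2))) := by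
  have : Nonempty (Fin d) := ⟨⟨0, hd⟩⟩
  have hdr : (0 : ℝ) < d := by exact_mod_cast hd
  rw [stdGaussian_eq_tilted, integral_tilted]
  have h1 : ∀ z : Vec d, (Real.exp (-(1 / 2) * ‖z‖ ^ 2) /
      ∫ x : Vec d, Real.exp (-(1 / 2) * ‖x‖ ^ 2)) • (‖z‖ ^ 3 * Real.exp (η * ‖z‖ ^ 2)) =
      (∫ x : Vec d, Real.exp (-(1 / 2) * ‖x‖ ^ 2))⁻¹ *
        (‖z‖ ^ 3 * Real.exp (-(1 / 2 - η) * ‖z‖ ^ 2)) := by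
    intro z
    rw [← exp_mul_norm_pow_mul_exp, smul_eq_mul]
    ring
  simp_rw [h1]
  rw [integral_const_mul, integral_norm_pow_mul_exp hd 3 (by linarith)]
  have h0 := integral_norm_pow_mul_exp hd 0 (by norm_num : (0 : ℝ) < 1 / 2)
  simp only [pow_zero, one_mul, Nat.cast_zero, add_zero] at h0
  rw [h0]
  have hball : 0 < volume.real (Metric.ball (0 : Vec d) 1) :=
    ENNReal.toReal_pos (Metric.measure_ball_pos _ _ one_pos).ne' measure_ball_lt_top.ne
  have hG : 0 < Real.Gamma ((d : ℝ) / 2) := Real.Gamma_pos_of_pos (by positivity)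
  -- The surface factor, `Γ(d/2)` apart, and `(1/2)^(-d/2)` cancel against the normalising integral;
  -- the remaining `(1/2)^(-3/2)` is the `2√2` of the constant.
  have e1 : (1 / 2 - η) = (1 / 2) * (1 - 2 * η) := by ring
  have e2 : -((d : ℝ) + 3) / 2 = -(d : ℝ) / 2 + (-(3 / 2)) := by ring
  have e3 : ((d : ℝ) + 3) / 2 = d / 2 + 3 / 2 := by ring
  have e4 : ((1 : ℝ) / 2) ^ (-(3 / 2) : ℝ) = 2 * √2 := by
    rw [one_div, Real.inv_rpow (by norm_num), Real.rpow_neg (by norm_num), inv_inv,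
      show (3 / 2 : ℝ) = 1 + 1 / 2 by norm_num, Real.rpow_add (by norm_num), Real.rpow_one,
      ← Real.sqrt_eq_rpow]
  rw [e1, Real.mul_rpow (by norm_num) (by linarith), Nat.cast_ofNat, e3]
  conv_lhs => enter [2, 2, 1, 1, 1]; rw [e2, Real.rpow_add (by norm_num), e4]
  have hp : (0 : ℝ) < (1 / 2) ^ (-(d : ℝ) / 2) := by positivity
  field_simp

/-! ### Total variation distance to an exponentially tilted measure -/

/-- The unnormalised mass of every set, and the normalising constant `Z`, each change by at most
`D`, and `Z ≥ 1 - D`. -/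
lemma tvDist_tilted_le {α : Type*} [MeasurableSpace α] (γ : Measure α) [IsProbabilityMeasure γ]
    {g : α → ℝ} (hg : Integrable (fun x => Real.exp (g x)) γ)
    {D : ℝ} (hD : ∫ x, |Real.exp (g x) - 1| ∂γ ≤ D) (hD1 : D < 1) :
    tvDist (γ.tilted g) γ ≤ 2 * D / (1 - D) := by
  have hint : Integrable (fun x => Real.exp (g x) - 1) γ := hg.sub (integrable_const 1)
  set Z := ∫ x, Real.exp (g x) ∂γ with hZ
  have hA : ∀ A : Set α, |∫ x in A, (Real.exp (g x) - 1) ∂γ| ≤ D := fun A =>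
    (abs_integral_le_integral_abs.trans
      (setIntegral_le_integral hint.abs (ae_of_all _ fun x => abs_nonneg _))).trans hD
  have hZ1 : |Z - 1| ≤ D := by
    have := hA univ
    rwa [setIntegral_univ, integral_sub hg (integrable_const 1), integral_const, probReal_univ,
      one_smul] at this
  have hZD : 1 - D ≤ Z := by linarith [(abs_le.1 hZ1).1]
  have hZ0 : 0 < Z := by linarith
  have hD0 : 0 ≤ D := (abs_nonneg _).trans hZ1
  have : Nonempty {A : Set α // MeasurableSet A} := ⟨⟨∅, MeasurableSet.empty⟩⟩
  refine ciSup_le fun ⟨A, hAm⟩ => ?_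
  have h1 : (γ.tilted g).real A = (∫ x in A, Real.exp (g x) ∂γ) / Z := by
    rw [Measure.real, tilted_apply_eq_ofReal_integral, ENNReal.toReal_ofReal, integral_div]
    exact integral_nonneg fun x => div_nonneg (Real.exp_pos _).le hZ0.le
  have h2 : ∫ x in A, (Real.exp (g x) - 1) ∂γ = (∫ x in A, Real.exp (g x) ∂γ) - γ.real A := by
    rw [integral_sub hg.integrableOn (integrable_const 1)]
    simp
  have h3 : (γ.tilted g).real A - γ.real A =
      ((∫ x in A, (Real.exp (g x) - 1) ∂γ) - (Z - 1) * γ.real A) / Z := by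
    rw [h1, h2]
    field_simp
    ring
  have h4 : |(Z - 1) * γ.real A| ≤ D := by
    rw [abs_mul, abs_of_nonneg (measureReal_nonneg : 0 ≤ γ.real A)]
    calc |Z - 1| * γ.real A ≤ D * 1 := by gcongr; exact measureReal_le_one
      _ = D := mul_one D
  rw [h3, abs_div, abs_of_pos hZ0]
  gcongr
  rw [abs_le] at h4 ⊢
  have h5 := abs_le.1 (hA A)
  constructor <;> linarith

lemma abs_exp_sub_one_le_mul_exp (x : ℝ) : |Real.exp x - 1| ≤ |x| * Real.exp |x| := by
  rw [abs_le]
  constructor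
  · have h1 := Real.add_one_le_exp x
    have h2 : |x| * 1 ≤ |x| * Real.exp |x| := by
      gcongr
      exact Real.one_le_exp (abs_nonneg x)
    linarith [neg_abs_le x]
  · have h1 := Real.add_one_le_exp (-x)
    have h2 : Real.exp x * Real.exp (-x) = 1 := by rw [← Real.exp_add]; simp
    have h3 : Real.exp x - 1 ≤ x * Real.exp x := by nlinarith [Real.exp_pos x]
    refine h3.trans ?_
    gcongr <;> exact le_abs_self x

lemma measurableEmbedding_affine (m : Vec d) {S : Matrix (Fin d) (Fin d) ℝ} (hS : S.PosDef) :
    MeasurableEmbedding fun z => m + sqrtMap S z :=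
  Continuous.measurableEmbedding (by fun_prop)
    fun _ _ hab => sqrtMap_injective hS (add_left_cancel hab)

/-- If a continuous function `g` is bounded by a small quadratic and by a small cubic function of
the distance from the mean, then tilting a Gaussian measure by `g` changes it little. -/
lemma tvDist_tilted_multivariateGaussian_le (hd : 0 < d) (m : Vec d)
    {S : Matrix (Fin d) (Fin d) ℝ} (hS : S.PosDef) {g : Vec d → ℝ} (hg : Continuous g)
    {k η q : ℝ} (hη : η < 1 / 2) (hk : 0 ≤ k)
    (hcube : ∀ x, |g x| ≤ k * wnorm S (x - m) ^ 3)
    (hsq : ∀ x, |g x| ≤ η * wnorm S (x - m) ^ 2)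
    (hq : k * ((1 - 2 * η) ^ (-((d : ℝ) + 3) / 2) * (2 * √2 *
        (Real.Gamma ((d : ℝ) / 2 + 3 / 2) / Real.Gamma ((d : ℝ) / 2)))) ≤ q) (hq1 : q < 1) :
    tvDist ((multivariateGaussian m S).tilted g) (multivariateGaussian m S) ≤
      2 * q / (1 - q) := by
  have he := measurableEmbedding_affine m hS
  have hmap : multivariateGaussian m S =
    (stdGaussian (Vec d)).map fun z => m + sqrtMap S z := rfl
  have hcube' : ∀ z, |g (m + sqrtMap S z)| ≤ k * ‖z‖ ^ 3 := fun z => by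
    simpa [wnorm_sqrtMap hS] using hcube (m + sqrtMap S z)
  have hsq' : ∀ z, |g (m + sqrtMap S z)| ≤ η * ‖z‖ ^ 2 := fun z => by
    simpa [wnorm_sqrtMap hS] using hsq (m + sqrtMap S z)
  have hint : Integrable (fun x => Real.exp (g x)) (multivariateGaussian m S) := by
    rw [hmap, he.integrable_map_iff]
    refine (integrable_stdGaussian_norm_pow_mul_exp hd 0 hη).mono'
      (Continuous.aestronglyMeasurable (by fun_prop)) (ae_of_all _ fun z => ?_)
    rw [pow_zero, one_mul, Function.comp_apply, Real.norm_of_nonneg (Real.exp_pos _).le]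
    exact Real.exp_le_exp.2 ((le_abs_self _).trans (hsq' z))
  refine tvDist_tilted_le _ hint ?_ hq1
  rw [hmap, he.integral_map]
  refine le_trans ?_ hq
  rw [← integral_stdGaussian_norm_cube_mul_exp hd hη, ← integral_const_mul]
  refine integral_mono_of_nonneg (ae_of_all _ fun z => abs_nonneg _)
    ((integrable_stdGaussian_norm_pow_mul_exp hd 3 hη).const_mul k) (ae_of_all _ fun z => ?_)
  -- The cubic bound goes into the prefactor and supplies the smallness; the quadratic bound goes
  -- into the exponent and supplies integrability.
  refine (abs_exp_sub_one_le_mul_exp _).trans ?_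
  simp only [← mul_assoc]
  gcongr
  · exact hcube' z
  · exact hsq' z

/-! ### Taylor estimates along lines -/

lemma abs_le_of_abs_deriv_le_pow {h h' : ℝ → ℝ} {c : ℝ} {n : ℕ}
    (hd : ∀ t, HasDerivAt h (h' t) t) (h0 : h 0 = 0)
    (hb : ∀ t ∈ Icc (0 : ℝ) 1, |h' t| ≤ c * t ^ n) :
    ∀ t ∈ Icc (0 : ℝ) 1, |h t| ≤ c / (n + 1) * t ^ (n + 1) := by
  intro t ht
  have hB : ∀ x : ℝ, HasDerivAt (fun t : ℝ => c / (n + 1) * t ^ (n + 1)) (c * x ^ n) x := by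
    intro x
    have := (hasDerivAt_pow (n + 1) x).const_mul (c / ((n : ℝ) + 1))
    refine this.congr_deriv ?_
    have : (n : ℝ) + 1 ≠ 0 := by positivity
    push_cast
    field_simp
  have := image_norm_le_of_norm_deriv_right_le_deriv_boundary (a := 0) (b := 1)
    (f := h) (f' := h') (fun x _ => (hd x).continuousAt.continuousWithinAt)
    (fun x _ => (hd x).hasDerivWithinAt) (B := fun t : ℝ => c / (n + 1) * t ^ (n + 1))
    (by simp [h0]) hB (fun x hx => hb x ⟨hx.1, hx.2.le⟩) ht
  simpa using this

/-- Integrating the bound on `f₃` three times from 0 produces the factors 1, 1/2, 1/3. -/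
lemma abs_sub_quadratic_le {f f₁ f₂ f₃ : ℝ → ℝ} {c : ℝ}
    (h₁ : ∀ t, HasDerivAt f (f₁ t) t) (h₂ : ∀ t, HasDerivAt f₁ (f₂ t) t)
    (h₃ : ∀ t, HasDerivAt f₂ (f₃ t) t) (hf0 : f 0 = 0) (hf1 : f₁ 0 = 0)
    (hb : ∀ t, |f₃ t| ≤ c) : |f 1 - 1 / 2 * f₂ 0| ≤ c / 6 := by
  have k₂ := abs_le_of_abs_deriv_le_pow (h := fun t => f₂ t - f₂ 0) (h' := f₃) (c := c) (n := 0)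
    (fun t => (h₃ t).sub_const _) (by simp) (fun t _ => by simpa using hb t)
  have k₁ := abs_le_of_abs_deriv_le_pow (h := fun t => f₁ t - t * f₂ 0)
    (h' := fun t => f₂ t - f₂ 0)
    (fun t => ((h₂ t).sub ((hasDerivAt_id t).mul_const (f₂ 0))).congr_deriv (by ring))
    (by simp [hf1]) k₂
  have k₀ := abs_le_of_abs_deriv_le_pow (h := fun t => f t - 1 / 2 * t ^ 2 * f₂ 0)
    (h' := fun t => f₁ t - t * f₂ 0)
    (fun t => by
      have := (h₁ t).sub (((hasDerivAt_pow 2 t).const_mul (1 / 2)).mul_const (f₂ 0))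
      exact this.congr_deriv (by
        simp only [Nat.cast_ofNat, Nat.reduceSub, pow_one]
        ring)) (by simp [hf0]) k₁ 1 (by simp)
  norm_num at k₀ ⊢
  linarith

/-- A function which differs from a quadratic polynomial by at most `b * (1 + |t|)` and which is
bounded by `k * |t| ^ 3` near zero is bounded by a multiple of `t ^ 2`. -/
lemma abs_le_mul_sq_of_quadratic_add {r p : ℝ → ℝ} {c₀ c₁ c₂ b k : ℝ} (hk : 0 ≤ k)
    (hr : ∀ t, r t = c₀ + c₁ * t + c₂ * t ^ 2 + p t) (hp : ∀ t, |p t| ≤ b * (1 + |t|))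
    (hr3 : ∀ t, |r t| ≤ k * |t| ^ 3) (t : ℝ) : |r t| ≤ (8 * b + 2 * k) * t ^ 2 := by
  have hb : 0 ≤ b := by simpa using (abs_nonneg _).trans (hp 0)
  rcases le_total |t| 1 with h | h
  · refine (hr3 t).trans ?_
    have h2 : |t| ^ 3 = |t| * t ^ 2 := by rw [pow_succ', sq_abs]
    have : |t| * t ^ 2 ≤ 1 * t ^ 2 := by gcongr
    rw [h2]
    nlinarith [mul_le_mul_of_nonneg_left this hk, mul_nonneg hb (sq_nonneg t),
      mul_nonneg hk (sq_nonneg t)]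
  -- For `|t| ≥ 1` the coefficients are recovered by interpolation at 0, 1 and -1, where `r` and `p`
  -- are both controlled; then `1` and `|t|` are absorbed into `t²`.
  · have e0 := hr 0
    have e1 := hr 1
    have e2 := hr (-1)
    have p0 := abs_le.1 (hp 0)
    have p1 := abs_le.1 (hp 1)
    have p2 := abs_le.1 (hp (-1))
    have r0 := abs_le.1 (hr3 0)
    have r1 := abs_le.1 (hr3 1)
    have r2 := abs_le.1 (hr3 (-1))
    norm_num at e0 e1 e2 p0 p1 p2 r0 r1 r2
    have b0 : |c₀| ≤ b := abs_le.2 ⟨by linarith, by linarith⟩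
    have b1 : |c₁| ≤ 2 * b + k := abs_le.2 ⟨by linarith, by linarith⟩
    have b2 : |c₂| ≤ 3 * b + k := abs_le.2 ⟨by linarith, by linarith⟩
    have ht : |t| ≤ t ^ 2 := by rw [← sq_abs]; nlinarith
    have ht1 : 1 ≤ t ^ 2 := h.trans ht
    calc |r t| = |c₀ + c₁ * t + c₂ * t ^ 2 + p t| := by rw [hr]
      _ ≤ |c₀| + |c₁| * |t| + |c₂| * t ^ 2 + |p t| := by
        refine (abs_add_le _ _).trans (add_le_add_left ((abs_add_le _ _).trans
          (add_le_add ((abs_add_le _ _).trans_eq ?_) ?_)) _)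
        · rw [abs_mul]
        · rw [abs_mul, abs_of_nonneg (sq_nonneg t)]
      _ ≤ b * t ^ 2 + (2 * b + k) * t ^ 2 + (3 * b + k) * t ^ 2 + b * (t ^ 2 + t ^ 2) := by
        gcongr
        · exact b0.trans (by nlinarith)
        · exact (hp t).trans (by gcongr)
      _ = (8 * b + 2 * k) * t ^ 2 := by ring

lemma hasDerivAt_iteratedFDeriv_line {E G : Type*} [NormedAddCommGroup E] [NormedSpace ℝ E]
    [NormedAddCommGroup G] [NormedSpace ℝ G] {f : E → G} {n : ℕ} (hf : ContDiff ℝ n f)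
    {j : ℕ} (hj : j < n) (x v : E) (t : ℝ) :
    HasDerivAt (fun t : ℝ => iteratedFDeriv ℝ j f (x + t • v) fun _ => v)
      (iteratedFDeriv ℝ (j + 1) f (x + t • v) fun _ => v) t := by
  have h1 : DifferentiableAt ℝ (iteratedFDeriv ℝ j f) (x + t • v) :=
    hf.differentiable_iteratedFDeriv (by exact_mod_cast hj) _
  have h2 : HasDerivAt (fun t : ℝ => x + t • v) v t := by
    simpa using ((hasDerivAt_id t).smul_const v).const_add x
  have h3 := h1.hasFDerivAt.comp_hasDerivAt t h2
  have h4 := ((ContinuousMultilinearMap.apply ℝ (fun _ : Fin j => E) G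
    (fun _ => v)).hasFDerivAt).comp_hasDerivAt t h3
  exact h4

/-! ### The weighted norms of the derivatives -/

/-- Homogeneity: rescale `v` to weighted length one. If its length is zero then `v = 0`, and `j = 0`
is separate because of `0⁰ = 1`. -/
lemma norm_iteratedFDeriv_apply_le {S : Matrix (Fin d) (Fin d) ℝ} (hS : S.PosDef) (j : ℕ)
    {F : Vec d → Vec d} {x : Vec d} {c : ℝ} (hc : diffNorm S j F x ≤ c) (v : Vec d) :
    ‖iteratedFDeriv ℝ j F x fun _ => v‖ ≤ c * wnorm S v ^ j := by
  have key : ∀ h : Fin j → Vec d, (∀ i, wnorm S (h i) ≤ 1) → ‖iteratedFDeriv ℝ j F x h‖ ≤ c := by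
    intro h hh
    refine le_trans ?_ hc
    unfold diffNorm
    refine le_csSup ?_ ⟨h, hh, rfl⟩
    -- The supremum is meaningful only for a bounded set; the weighted unit ball is the image of the
    -- Euclidean one under `S^{1/2}`.
    refine ⟨‖iteratedFDeriv ℝ j F x‖ * ‖sqrtMap S‖ ^ j, ?_⟩
    rintro r ⟨h, hh, rfl⟩
    refine (ContinuousMultilinearMap.le_opNorm _ _).trans ?_
    gcongr
    refine (Finset.prod_le_prod (g := fun _ => ‖sqrtMap S‖) (fun _ _ => norm_nonneg _)
      fun i _ => ?_).trans_eq (by simp)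
    obtain ⟨z, hz⟩ := sqrtMap_surjective hS (h i)
    have h1 := hh i
    rw [← hz, wnorm_sqrtMap hS] at h1
    rw [← hz]
    exact (ContinuousLinearMap.le_opNorm _ _).trans (by nlinarith [norm_nonneg (sqrtMap S)])
  rcases eq_or_ne (wnorm S v) 0 with h0 | h0
  · have hv := wnorm_eq_zero hS h0
    rcases Nat.eq_zero_or_pos j with rfl | hj
    · simpa using key (fun _ => v) (fun i => i.elim0)
    · rw [ContinuousMultilinearMap.map_coord_zero _ (⟨0, hj⟩ : Fin j) hv, h0, zero_pow hj.ne']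
      simp
  · have hpos : 0 < wnorm S v := lt_of_le_of_ne (wnorm_nonneg S v) h0.symm
    have h1 := key (fun _ => (wnorm S v)⁻¹ • v) fun _ => by
      rw [wnorm_smul, abs_of_pos (by positivity), inv_mul_cancel₀ h0]
    rw [(iteratedFDeriv ℝ j F x).map_smul_univ (fun _ => (wnorm S v)⁻¹) (fun _ => v)] at h1
    rw [norm_smul, Finset.prod_const, Finset.card_univ, Fintype.card_fin, norm_pow,
      Real.norm_of_nonneg (by positivity), inv_pow, inv_mul_le_iff₀ (by positivity)] at h1
    linarith

lemma norm_toEuclideanLin_le (A : Matrix (Fin d) (Fin d) ℝ) {S : Matrix (Fin d) (Fin d) ℝ}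
    (hS : S.PosDef) (v : Vec d) :
    ‖Matrix.toEuclideanLin A v‖ ≤ opNorm (A * matSqrt S) * wnorm S v := by
  obtain ⟨z, rfl⟩ := sqrtMap_surjective hS v
  rw [wnorm_sqrtMap hS, opNorm, map_mul]
  exact ContinuousLinearMap.le_opNorm
    (Matrix.toEuclideanCLM (𝕜 := ℝ) A * Matrix.toEuclideanCLM (𝕜 := ℝ) (matSqrt S)) z

lemma norm_toEuclideanLin_le_opNorm (A : Matrix (Fin d) (Fin d) ℝ) (v : Vec d) :
    ‖Matrix.toEuclideanLin A v‖ ≤ opNorm A * ‖v‖ :=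
  ContinuousLinearMap.le_opNorm (Matrix.toEuclideanCLM (𝕜 := ℝ) A) v

lemma opNorm_nonneg (A : Matrix (Fin d) (Fin d) ℝ) : 0 ≤ opNorm A := norm_nonneg _

lemma dotProduct_hessian (f : Vec d → ℝ) (x v : Vec d) :
    v.ofLp ⬝ᵥ (hessian f x *ᵥ v.ofLp) = iteratedFDeriv ℝ 2 f x fun _ => v := by
  have hv : v = ∑ j, v j • EuclideanSpace.single j (1 : ℝ) := by
    simpa using ((EuclideanSpace.basisFun (Fin d) ℝ).sum_repr v).symm
  have h1 : ∀ a b : Vec d, iteratedFDeriv ℝ 2 f x ![a, b] = fderiv ℝ (fderiv ℝ f) x a b := by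
    intro a b
    rw [iteratedFDeriv_two_apply]
    rfl
  rw [iteratedFDeriv_two_apply]
  conv_rhs => rw [hv]
  simp only [map_sum, map_smul, _root_.sum_apply, _root_.smul_apply,
    smul_eq_mul, dotProduct, Matrix.mulVec, hessian, Matrix.of_apply, h1, Finset.mul_sum]
  rw [Finset.sum_comm]
  refine Finset.sum_congr rfl fun i _ => Finset.sum_congr rfl fun j _ => ?_
  ring

/-- In the norm weighted by the inverse Hessian, the second-order Taylor term is exactly half the
squared norm. -/
lemma wnorm_inv_hessian_sq {f : Vec d → ℝ} {x : Vec d} (h : (hessian f x).PosDef) (v : Vec d) :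
    wnorm (hessian f x)⁻¹ v ^ 2 = iteratedFDeriv ℝ 2 f x fun _ => v := by
  rw [wnorm, Matrix.nonsing_inv_nonsing_inv _ h.det_pos.ne'.isUnit, ← dotProduct_hessian,
    Real.sq_sqrt]
  simpa using h.posSemidef.dotProduct_mulVec_nonneg v.ofLp

lemma wnorm_line_sq {S : Matrix (Fin d) (Fin d) ℝ} (hS : S.PosDef) (a v : Vec d) :
    ∃ c₀ c₁ c₂ : ℝ, ∀ t : ℝ, wnorm S (a + t • v) ^ 2 = c₀ + c₁ * t + c₂ * t ^ 2 := by
  obtain ⟨z, rfl⟩ := sqrtMap_surjective hS a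
  obtain ⟨w, rfl⟩ := sqrtMap_surjective hS v
  refine ⟨‖z‖ ^ 2, 2 * inner ℝ z w, ‖w‖ ^ 2, fun t => ?_⟩
  rw [← map_smul, ← map_add, wnorm_sqrtMap hS, norm_add_sq_real, inner_smul_right, norm_smul,
    mul_pow, Real.norm_eq_abs, sq_abs]
  ring

lemma contDiff_wnorm_sq {S : Matrix (Fin d) (Fin d) ℝ} (hS : S.PosDef) {n : WithTop ℕ∞} :
    ContDiff ℝ n fun x => wnorm S x ^ 2 := by
  have h : ∀ x : Vec d, wnorm S x ^ 2 = x.ofLp ⬝ᵥ (S⁻¹ *ᵥ x.ofLp) := fun x => by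
    rw [wnorm, Real.sq_sqrt]
    simpa using hS.inv.posSemidef.dotProduct_mulVec_nonneg x.ofLp
  simp_rw [h, dotProduct, Matrix.mulVec, dotProduct]
  fun_prop

/-! ### The remainder of the quadratic approximation of the potential -/

lemma contDiff_perturbedPotential (ε : ℝ) (A : Matrix (Fin d) (Fin d) ℝ) {F : Vec d → Vec d}
    (hF : ContDiff ℝ 3 F) (m₀ : Vec d) {S₀ : Matrix (Fin d) (Fin d) ℝ} (hS₀ : S₀.PosDef)
    (τ : ℝ) (y xhat : Vec d) : ContDiff ℝ 3 (perturbedPotential ε A F m₀ S₀ τ y xhat) := by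
  have h1 : ContDiff ℝ 3 fun x : Vec d => wnorm S₀ (x - m₀) ^ 2 :=
    (contDiff_wnorm_sq hS₀).comp (contDiff_id.sub contDiff_const)
  have h2 : ContDiff ℝ 3 fun x : Vec d => Matrix.toEuclideanLin A x :=
    (Matrix.toEuclideanCLM (𝕜 := ℝ) A).contDiff
  have h3 : ContDiff ℝ 3 fun x : Vec d => y - (Matrix.toEuclideanLin A x + τ • F x) :=
    contDiff_const.sub (h2.add (hF.const_smul τ))
  have h4 : ContDiff ℝ 3 (misfit (perturbedMap A F τ) y) := contDiff_const.mul (h3.norm_sq ℝ)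
  have h5 : ContDiff ℝ 3 (gaussianNegLogDensity m₀ S₀) :=
    ((contDiff_const.mul h1).add contDiff_const).add contDiff_const
  exact ((h4.add (contDiff_const.mul h5)).sub contDiff_const).sub contDiff_const

/-- Isolates the residual: the prior is a quadratic polynomial on each line and disappears after
three derivatives. -/
lemma perturbedPotential_line (ε : ℝ) (A : Matrix (Fin d) (Fin d) ℝ) (F : Vec d → Vec d)
    (m₀ : Vec d) {S₀ : Matrix (Fin d) (Fin d) ℝ} (hS₀ : S₀.PosDef) (τ : ℝ) (y xhat v : Vec d) :
    ∃ c₀ c₁ c₂ : ℝ, ∀ t : ℝ, perturbedPotential ε A F m₀ S₀ τ y xhat (xhat + t • v) =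
      c₀ + c₁ * t + c₂ * t ^ 2 + 1 / 2 * ‖Matrix.toEuclideanLin A xhat - y +
        t • Matrix.toEuclideanLin A v + τ • F (xhat + t • v)‖ ^ 2 := by
  obtain ⟨c₀, c₁, c₂, h⟩ := wnorm_line_sq hS₀ (xhat - m₀) v
  let r := misfit (perturbedMap A F τ) y xhat + ε * (1 / 2 * wnorm S₀ (xhat - m₀) ^ 2)
  refine ⟨ε / 2 * c₀ - r, ε / 2 * c₁, ε / 2 * c₂, fun t => ?_⟩
  have h1 : xhat + t • v - m₀ = xhat - m₀ + t • v := by abel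
  have h2 : misfit (perturbedMap A F τ) y (xhat + t • v) = 1 / 2 *
      ‖Matrix.toEuclideanLin A xhat - y + t • Matrix.toEuclideanLin A v +
        τ • F (xhat + t • v)‖ ^ 2 := by
    rw [misfit, norm_sub_rev, perturbedMap, map_add, map_smul]
    congr 3
    abel
  rw [perturbedPotential, potential, h2]
  simp only [gaussianNegLogDensity, h1, h, r]
  ring

/-- Third-order Taylor expansion along the line through `x̂` in direction `v`. The affine part of
the residual has no second derivative, so each term of `ψ₃` carries a factor `τ`. -/
lemma abs_remainder_le_cube (ε : ℝ) (A : Matrix (Fin d) (Fin d) ℝ) {F : Vec d → Vec d}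
    (hF : ContDiff ℝ 3 F) (m₀ : Vec d) {S₀ : Matrix (Fin d) (Fin d) ℝ} (hS₀ : S₀.PosDef)
    {τ : ℝ} (hτ : 0 ≤ τ) (y xhat : Vec d) {S : Matrix (Fin d) (Fin d) ℝ}
    (hmin : IsUniqueMinimizer (perturbedPotential ε A F m₀ S₀ τ y xhat) xhat)
    (hpos : (hessian (perturbedPotential ε A F m₀ S₀ τ y xhat) xhat).PosDef)
    (hS : S = (hessian (perturbedPotential ε A F m₀ S₀ τ y xhat) xhat)⁻¹)
    {C₀ C₁ C₂ C₃ M : ℝ} (hC₃ : 0 ≤ C₃) (hM : 0 ≤ M)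
    (hF₀ : ∀ x, diffNorm S 0 F x ≤ C₀) (hF₁ : ∀ x, diffNorm S 1 F x ≤ C₁)
    (hF₂ : ∀ x, diffNorm S 2 F x ≤ C₂) (hF₃ : ∀ x, diffNorm S 3 F x ≤ C₃)
    (hFM : ∀ x, x ∉ Metric.closedBall (0 : Vec d) M → iteratedFDeriv ℝ 3 F x = 0) (v : Vec d) :
    |perturbedPotential ε A F m₀ S₀ τ y xhat (xhat + v) - 1 / 2 * wnorm S v ^ 2| ≤
      (constV C₂ C₃ M A S y * τ + constW C₀ C₁ C₂ C₃ * τ ^ 2) / 6 * wnorm S v ^ 3 := by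
  set I := perturbedPotential ε A F m₀ S₀ τ y xhat with hI
  have hSpos : S.PosDef := hS ▸ hpos.inv
  have hIc : ContDiff ℝ 3 I := contDiff_perturbedPotential ε A hF m₀ hS₀ τ y xhat
  set w := wnorm S v with hw
  have hw0 : 0 ≤ w := wnorm_nonneg S v
  obtain ⟨c₀, c₁, c₂, hline⟩ := perturbedPotential_line ε A F m₀ hS₀ τ y xhat v
  set a := Matrix.toEuclideanLin A xhat - y with ha
  set b := Matrix.toEuclideanLin A v with hb
  let f : ℕ → ℝ → Vec d := fun j t => iteratedFDeriv ℝ j F (xhat + t • v) fun _ => v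
  have hf0 : ∀ t, f 0 t = F (xhat + t • v) := fun t => by simp [f]
  have hfd : ∀ j < 3, ∀ t, HasDerivAt (f j) (f (j + 1) t) t := fun j hj t =>
    hasDerivAt_iteratedFDeriv_line hF hj xhat v t
  let g : ℝ → Vec d := fun t => a + t • b + τ • f 0 t
  let g₁ : ℝ → Vec d := fun t => b + τ • f 1 t
  have hg : ∀ t, HasDerivAt g (g₁ t) t := fun t => by
    have h1 := (((hasDerivAt_id t).smul_const b).const_add a).add
      ((hfd 0 (by norm_num) t).const_smul τ)
    exact h1.congr_deriv (by simp [g₁])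
  have hg₁ : ∀ t, HasDerivAt g₁ (τ • f 2 t) t := fun t =>
    ((hfd 1 (by norm_num) t).const_smul τ).const_add b
  have hg₂ : ∀ t, HasDerivAt (fun t => τ • f 2 t) (τ • f 3 t) t := fun t =>
    (hfd 2 (by norm_num) t).const_smul τ
  let ψ : ℝ → ℝ := fun t => I (xhat + t • v)
  let ψ₁ : ℝ → ℝ := fun t => c₁ + 2 * c₂ * t + inner ℝ (g t) (g₁ t)
  let ψ₂ : ℝ → ℝ := fun t => 2 * c₂ + (inner ℝ (g t) (τ • f 2 t) + inner ℝ (g₁ t) (g₁ t))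
  let ψ₃ : ℝ → ℝ := fun t => inner ℝ (g t) (τ • f 3 t) + 3 * inner ℝ (g₁ t) (τ • f 2 t)
  have hψ : ψ = fun t => c₀ + c₁ * t + c₂ * t ^ 2 + 1 / 2 * ‖g t‖ ^ 2 := by
    funext t
    simp only [ψ, g, hf0]
    exact hline t
  have h₁ : ∀ t, HasDerivAt ψ (ψ₁ t) t := fun t => by
    rw [hψ]
    have h1 := ((((hasDerivAt_id t).const_mul c₁).const_add c₀).add
      ((hasDerivAt_pow 2 t).const_mul c₂)).add ((hg t).norm_sq.const_mul (1 / 2))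
    refine h1.congr_deriv ?_
    simp only [ψ₁, Nat.cast_ofNat, Nat.reduceSub, pow_one]
    ring
  have h₂ : ∀ t, HasDerivAt ψ₁ (ψ₂ t) t := fun t => by
    have h1 := (((hasDerivAt_id t).const_mul (2 * c₂)).const_add c₁).add ((hg t).inner ℝ (hg₁ t))
    exact h1.congr_deriv (by simp only [ψ₂]; ring)
  have h₃ : ∀ t, HasDerivAt ψ₂ (ψ₃ t) t := fun t => by
    have h1 := (((hg t).inner ℝ (hg₂ t)).add ((hg₁ t).inner ℝ (hg₁ t))).const_add (2 * c₂)
    refine h1.congr_deriv ?_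
    simp only [ψ₃]
    rw [real_inner_comm (g₁ t) (τ • f 2 t)]
    ring
  have hψ0 : ψ 0 = 0 := by
    simp only [ψ, zero_smul, add_zero, hI, perturbedPotential, potential]
    ring
  have hψ10 : ψ₁ 0 = 0 := by
    refine IsLocalMin.hasDerivAt_eq_zero (f := ψ) (a := 0) (Eventually.of_forall fun t => ?_) (h₁ 0)
    simp only [ψ, zero_smul, add_zero]
    rcases eq_or_ne (xhat + t • v) xhat with h | h
    · rw [h]
    · exact (hmin _ h).le
  -- Uniqueness of derivatives identifies the explicit `ψ₂` with the Hessian form, without expanding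
  -- the Hessian.
  have hψ20 : ψ₂ 0 = w ^ 2 := by
    have e0 : ∀ t, HasDerivAt ψ (iteratedFDeriv ℝ 1 I (xhat + t • v) fun _ => v) t := fun t => by
      have := hasDerivAt_iteratedFDeriv_line hIc (show 0 < 3 by norm_num) xhat v t
      simpa using this
    have e1 : ψ₁ = fun t => iteratedFDeriv ℝ 1 I (xhat + t • v) fun _ => v :=
      funext fun t => (h₁ t).unique (e0 t)
    have e2 := hasDerivAt_iteratedFDeriv_line hIc (show 1 < 3 by norm_num) xhat v 0
    have e3 := h₂ 0
    rw [e1] at e3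
    rw [e3.unique e2, hw, hS, wnorm_inv_hessian_sq hpos, zero_smul, add_zero]
  have hbw : ‖b‖ ≤ opNorm (A * matSqrt S) * w := norm_toEuclideanLin_le A hSpos v
  have n0 : ∀ t, ‖f 0 t‖ ≤ C₀ := fun t =>
    (norm_iteratedFDeriv_apply_le hSpos 0 (hF₀ (xhat + t • v)) v).trans_eq (by simp)
  have n1 : ∀ t, ‖f 1 t‖ ≤ C₁ * w := fun t =>
    (norm_iteratedFDeriv_apply_le hSpos 1 (hF₁ (xhat + t • v)) v).trans_eq (by rw [pow_one])
  have n2 : ∀ t, ‖f 2 t‖ ≤ C₂ * w ^ 2 := fun t =>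
    norm_iteratedFDeriv_apply_le hSpos 2 (hF₂ (xhat + t • v)) v
  have n3 : ∀ t, ‖f 3 t‖ ≤ C₃ * w ^ 3 := fun t =>
    norm_iteratedFDeriv_apply_le hSpos 3 (hF₃ (xhat + t • v)) v
  have hC₀ : 0 ≤ C₀ := (norm_nonneg _).trans (n0 0)
  have m1 : ∀ t, ‖g₁ t‖ ≤ (opNorm (A * matSqrt S) + τ * C₁) * w := fun t => by
    refine (norm_add_le _ _).trans ?_
    rw [norm_smul, Real.norm_of_nonneg hτ, add_mul, mul_assoc τ]
    gcongr
    exact n1 t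
  have i1 : ∀ t, |inner ℝ (g t) (τ • f 3 t)| ≤
      (opNorm A * M + ‖y‖ + τ * C₀) * (τ * (C₃ * w ^ 3)) := fun t => by
    have hA := opNorm_nonneg A
    -- The residual grows with `x`, but outside the ball it is paired with `D³F = 0`.
    by_cases hx : xhat + t • v ∈ Metric.closedBall (0 : Vec d) M
    · have hgn : ‖g t‖ ≤ opNorm A * M + ‖y‖ + τ * C₀ := by
        have : g t = Matrix.toEuclideanLin A (xhat + t • v) - y + τ • f 0 t := by
          simp only [g, ha, hb, map_add, map_smul]
          abel
        rw [this]
        refine (norm_add_le _ _).trans (add_le_add ((norm_sub_le _ _).trans ?_) ?_)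
        · gcongr
          refine (norm_toEuclideanLin_le_opNorm A _).trans ?_
          gcongr
          simpa using hx
        · rw [norm_smul, Real.norm_of_nonneg hτ]
          gcongr
          exact n0 t
      refine (abs_real_inner_le_norm _ _).trans ?_
      rw [norm_smul, Real.norm_of_nonneg hτ]
      gcongr
      exact n3 t
    · have : f 3 t = 0 := by simp [f, hFM _ hx]
      rw [this]
      simp only [smul_zero, inner_zero_right, abs_zero]
      positivity
  have i2 : ∀ t, |inner ℝ (g₁ t) (τ • f 2 t)| ≤
      (opNorm (A * matSqrt S) + τ * C₁) * w * (τ * (C₂ * w ^ 2)) := fun t => by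
    refine (abs_real_inner_le_norm _ _).trans ?_
    rw [norm_smul, Real.norm_of_nonneg hτ]
    have := (norm_nonneg _).trans (m1 t)
    gcongr
    · exact m1 t
    · exact n2 t
  have hb3 : ∀ t, |ψ₃ t| ≤
      (constV C₂ C₃ M A S y * τ + constW C₀ C₁ C₂ C₃ * τ ^ 2) * w ^ 3 := fun t => by
    refine (abs_add_le _ _).trans ?_
    rw [abs_mul, abs_of_pos (by norm_num : (0 : ℝ) < 3)]
    refine (add_le_add (i1 t) (mul_le_mul_of_nonneg_left (i2 t) (by norm_num))).trans_eq ?_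
    rw [constV, constW]
    ring
  have := abs_sub_quadratic_le h₁ h₂ h₃ hψ0 hψ10 hb3
  rw [hψ20] at this
  simp only [ψ, one_smul] at this
  refine this.trans_eq ?_
  ring

/-- On a line in a unit direction the remainder is a quadratic polynomial plus the terms containing
`F`. As `F` is bounded, these grow at most linearly with a factor `τ`, and the cubic bound near `x̂`
controls the polynomial. -/
lemma abs_remainder_le_sq (ε : ℝ) (A : Matrix (Fin d) (Fin d) ℝ) {F : Vec d → Vec d}
    (m₀ : Vec d) {S₀ : Matrix (Fin d) (Fin d) ℝ} (hS₀ : S₀.PosDef)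
    {τ : ℝ} (hτ : 0 ≤ τ) (y xhat : Vec d) {S : Matrix (Fin d) (Fin d) ℝ} (hS : S.PosDef)
    {C₀ k : ℝ} (hk : 0 ≤ k) (hF₀ : ∀ x, diffNorm S 0 F x ≤ C₀)
    (hcube : ∀ v, |perturbedPotential ε A F m₀ S₀ τ y xhat (xhat + v) - 1 / 2 * wnorm S v ^ 2| ≤
      k * wnorm S v ^ 3) (v : Vec d) :
    |perturbedPotential ε A F m₀ S₀ τ y xhat (xhat + v) - 1 / 2 * wnorm S v ^ 2| ≤
      (8 * (τ * (C₀ * (opNorm A * ‖xhat‖ + ‖y‖ + opNorm (A * matSqrt S)) + τ * C₀ ^ 2 / 2)) +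
        2 * k) * wnorm S v ^ 2 := by
  rcases eq_or_ne (wnorm S v) 0 with h0 | h0
  · have := hcube v
    rw [h0] at this ⊢
    simpa using this
  have hpos : 0 < wnorm S v := lt_of_le_of_ne (wnorm_nonneg S v) h0.symm
  obtain ⟨u, hu, hvu⟩ : ∃ u, wnorm S u = 1 ∧ v = wnorm S v • u := by
    refine ⟨(wnorm S v)⁻¹ • v, ?_, ?_⟩
    · rw [wnorm_smul, abs_of_pos (by positivity), inv_mul_cancel₀ h0]
    · rw [smul_smul, mul_inv_cancel₀ h0, one_smul]
  have hFn : ∀ x, ‖F x‖ ≤ C₀ := fun x => by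
    simpa using norm_iteratedFDeriv_apply_le hS 0 (hF₀ x) u
  have hC₀ : 0 ≤ C₀ := (norm_nonneg _).trans (hFn 0)
  obtain ⟨c₀, c₁, c₂, hline⟩ := perturbedPotential_line ε A F m₀ hS₀ τ y xhat u
  set a := Matrix.toEuclideanLin A xhat - y with ha
  set b := Matrix.toEuclideanLin A u with hb
  have han : ‖a‖ ≤ opNorm A * ‖xhat‖ + ‖y‖ :=
    (norm_sub_le _ _).trans (by gcongr; exact norm_toEuclideanLin_le_opNorm A xhat)
  have hbn : ‖b‖ ≤ opNorm (A * matSqrt S) := by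
    simpa [hu] using norm_toEuclideanLin_le A hS u
  set s := opNorm (A * matSqrt S) with hs
  set q := opNorm A * ‖xhat‖ + ‖y‖ with hq
  have hs0 : 0 ≤ s := opNorm_nonneg _
  have hq0 : 0 ≤ q := (norm_nonneg _).trans han
  let p : ℝ → ℝ := fun t => τ * inner ℝ (a + t • b) (F (xhat + t • u)) +
    τ ^ 2 / 2 * ‖F (xhat + t • u)‖ ^ 2
  have hp : ∀ t, |p t| ≤ τ * (C₀ * (q + s) + τ * C₀ ^ 2 / 2) * (1 + |t|) := fun t => by
    have hab : ‖a + t • b‖ ≤ (q + s) * (1 + |t|) := by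
      refine (norm_add_le _ _).trans ?_
      rw [norm_smul, Real.norm_eq_abs]
      nlinarith [mul_le_mul_of_nonneg_left hbn (abs_nonneg t), mul_nonneg hq0 (abs_nonneg t)]
    have h1 : |inner ℝ (a + t • b) (F (xhat + t • u))| ≤ (q + s) * (1 + |t|) * C₀ :=
      (abs_real_inner_le_norm _ _).trans (by gcongr; exact hFn _)
    have h2 : ‖F (xhat + t • u)‖ ^ 2 ≤ C₀ ^ 2 * (1 + |t|) := by
      have : ‖F (xhat + t • u)‖ ^ 2 ≤ C₀ ^ 2 := by gcongr; exact hFn _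
      nlinarith [mul_nonneg (sq_nonneg C₀) (abs_nonneg t)]
    calc |p t| ≤ τ * |inner ℝ (a + t • b) (F (xhat + t • u))| +
          τ ^ 2 / 2 * ‖F (xhat + t • u)‖ ^ 2 := by
          refine (abs_add_le _ _).trans_eq ?_
          rw [abs_mul, abs_of_nonneg hτ, abs_of_nonneg (a := τ ^ 2 / 2 * _) (by positivity)]
      _ ≤ τ * ((q + s) * (1 + |t|) * C₀) + τ ^ 2 / 2 * (C₀ ^ 2 * (1 + |t|)) := by gcongr
      _ = _ := by ring
  let r : ℝ → ℝ := fun t => perturbedPotential ε A F m₀ S₀ τ y xhat (xhat + t • u) - 1 / 2 * t ^ 2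
  have hws : ∀ t : ℝ, wnorm S (t • u) = |t| := fun t => by rw [wnorm_smul, hu, mul_one]
  have := abs_le_mul_sq_of_quadratic_add (r := r) (p := p) (c₀ := c₀ + 1 / 2 * ‖a‖ ^ 2)
    (c₁ := c₁ + inner ℝ a b) (c₂ := c₂ + 1 / 2 * ‖b‖ ^ 2 - 1 / 2) hk
    (fun t => by
      simp only [r, p]
      rw [hline t, norm_add_sq_real (a + t • b), norm_add_sq_real a, inner_smul_right,
        inner_smul_right, norm_smul, norm_smul, mul_pow, mul_pow, Real.norm_eq_abs,
        Real.norm_eq_abs, sq_abs, sq_abs]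
      ring) hp
    (fun t => by
      have := hcube (t • u)
      rwa [hws, sq_abs] at this) (wnorm S v)
  simp only [r] at this
  rwa [← hvu] at this

/-! ### The posterior distribution as a tilted Laplace approximation -/

lemma perturbedPosterior_eq_tilted_laplace {ε : ℝ} (hε : 0 < ε) (A : Matrix (Fin d) (Fin d) ℝ)
    (F : Vec d → Vec d) (m₀ : Vec d) {S₀ : Matrix (Fin d) (Fin d) ℝ} (hS₀ : S₀.PosDef)
    (τ : ℝ) (y xhat : Vec d)
    (hpos : (hessian (perturbedPotential ε A F m₀ S₀ τ y xhat) xhat).PosDef) :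
    perturbedPosterior ε A F m₀ S₀ τ y =
      (laplace ε (perturbedPotential ε A F m₀ S₀ τ y xhat) xhat).tilted fun x =>
        -(1 / ε) * (perturbedPotential ε A F m₀ S₀ τ y xhat x -
          1 / 2 * wnorm (hessian (perturbedPotential ε A F m₀ S₀ τ y xhat) xhat)⁻¹
            (x - xhat) ^ 2) := by
  set I := perturbedPotential ε A F m₀ S₀ τ y xhat with hI
  have hεS : (ε • (hessian I xhat)⁻¹).PosDef := hpos.inv.smul hε
  rw [perturbedPosterior, posterior, multivariateGaussian_eq_tilted m₀ hS₀,
    tilted_tilted (integrable_exp_wnorm m₀ hS₀), laplace, multivariateGaussian_eq_tilted xhat hεS,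
    tilted_tilted (integrable_exp_wnorm xhat hεS)]
  -- The exponents over Lebesgue measure differ by this constant, which comes from subtracting the
  -- value at `x̂` in the potential.
  rw [← tilted_add_const _ _ (1 / ε * misfit (perturbedMap A F τ) y xhat +
    1 / 2 * wnorm S₀ (xhat - m₀) ^ 2)]
  congr 1
  funext x
  simp only [Pi.add_apply, wnorm_scaled_sq _ hε hpos.inv]
  simp only [hI, perturbedPotential, potential, gaussianNegLogDensity]
  field_simp
  ring

/-! ### The estimate for fixed `τ` -/

lemma eq_sqrt_mul_wnorm_scaled {S : Matrix (Fin d) (Fin d) ℝ} (hS : S.PosDef) {ε : ℝ} (hε : 0 < ε)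
    (h : Vec d) : wnorm S h = √ε * wnorm (ε • S) h := by
  have h1 := wnorm_scaled_sq S hε hS h
  rw [← abs_of_nonneg (wnorm_nonneg S h), ← abs_of_nonneg (wnorm_nonneg (ε • S) h),
    ← abs_of_nonneg (Real.sqrt_nonneg ε), ← abs_mul, ← sq_eq_sq_iff_abs_eq_abs, mul_pow,
    Real.sq_sqrt hε.le, h1]
  field_simp

lemma constC_nonneg (d : ℕ) : 0 ≤ constC d := by
  have h1 : 0 ≤ Real.Gamma ((d : ℝ) / 2 + 3 / 2) := Real.Gamma_nonneg_of_nonneg (by positivity)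
  have h2 : 0 ≤ Real.Gamma ((d : ℝ) / 2) := Real.Gamma_nonneg_of_nonneg (by positivity)
  unfold constC
  positivity

/-- If the potential differs from its quadratic approximation by at most `k ‖x - x̂‖³` and by at
most a sufficiently small multiple `η` of `‖x - x̂‖²`, then the Laplace approximation is accurate
of order `√ε k`. -/
lemma tvDist_posterior_laplace_le (hd : 0 < d) {ε : ℝ} (hε : 0 < ε)
    (A : Matrix (Fin d) (Fin d) ℝ) {F : Vec d → Vec d} (hF : ContDiff ℝ 3 F) (m₀ : Vec d)
    {S₀ : Matrix (Fin d) (Fin d) ℝ} (hS₀ : S₀.PosDef) (τ : ℝ) (y xhat : Vec d)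
    {S : Matrix (Fin d) (Fin d) ℝ}
    (hpos : (hessian (perturbedPotential ε A F m₀ S₀ τ y xhat) xhat).PosDef)
    (hS : S = (hessian (perturbedPotential ε A F m₀ S₀ τ y xhat) xhat)⁻¹)
    {k η : ℝ} (hk : 0 ≤ k) (hη : η < 1 / 2)
    (hcube : ∀ v, |perturbedPotential ε A F m₀ S₀ τ y xhat (xhat + v) - 1 / 2 * wnorm S v ^ 2| ≤
      k * wnorm S v ^ 3)
    (hsq : ∀ v, |perturbedPotential ε A F m₀ S₀ τ y xhat (xhat + v) - 1 / 2 * wnorm S v ^ 2| ≤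
      η * wnorm S v ^ 2)
    (hη1 : (1 - 2 * η) ^ (-((d : ℝ) + 3) / 2) ≤ 6 / 5)
    (hsmall : √ε * k * (6 / 5 * (2 * √2 *
      (Real.Gamma ((d : ℝ) / 2 + 3 / 2) / Real.Gamma ((d : ℝ) / 2)))) ≤ 1 / 20) :
    tvDist (perturbedPosterior ε A F m₀ S₀ τ y)
        (laplace ε (perturbedPotential ε A F m₀ S₀ τ y xhat) xhat) ≤
      constC d * √ε * (3 * k) := by
  rw [perturbedPosterior_eq_tilted_laplace hε A F m₀ hS₀ τ y xhat hpos, laplace, ← hS]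
  have hIc := (contDiff_perturbedPotential ε A hF m₀ hS₀ τ y xhat).continuous
  set I := perturbedPotential ε A F m₀ S₀ τ y xhat with hI
  have hSpos : S.PosDef := hS ▸ hpos.inv
  have hεS : (ε • S).PosDef := hSpos.smul hε
  set r := Real.Gamma ((d : ℝ) / 2 + 3 / 2) / Real.Gamma ((d : ℝ) / 2) with hr
  have hr0 : 0 ≤ r := div_nonneg (Real.Gamma_nonneg_of_nonneg (by positivity))
    (Real.Gamma_nonneg_of_nonneg (by positivity))
  have habs : ∀ x, |-(1 / ε) * (I x - 1 / 2 * wnorm S (x - xhat) ^ 2)| =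
      1 / ε * |I (xhat + (x - xhat)) - 1 / 2 * wnorm S (x - xhat) ^ 2| := fun x => by
    rw [abs_mul, abs_neg, abs_of_pos (by positivity), add_sub_cancel]
  have hcont : Continuous fun x => -(1 / ε) * (I x - 1 / 2 * wnorm S (x - xhat) ^ 2) := by
    have := continuous_wnorm S
    fun_prop
  have hsε : √ε ^ 2 = ε := Real.sq_sqrt hε.le
  -- Since `‖·‖_S = √ε ‖·‖_{εS}`, the cubic constant `k/ε` turns into `√ε k`, while the quadratic
  -- constant `η/ε` turns into `η`.
  refine (tvDist_tilted_multivariateGaussian_le hd xhat hεS hcont (k := √ε * k) (η := η)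
    (q := √ε * k * (6 / 5 * (2 * √2 * r))) hη (by positivity) (fun x => ?_) (fun x => ?_)
    ?_ (by linarith)).trans ?_
  · rw [habs]
    calc 1 / ε * |I (xhat + (x - xhat)) - 1 / 2 * wnorm S (x - xhat) ^ 2|
        ≤ 1 / ε * (k * wnorm S (x - xhat) ^ 3) := by gcongr; exact hcube _
      _ = 1 / ε * √ε ^ 2 * (√ε * k * wnorm (ε • S) (x - xhat) ^ 3) := by
        rw [eq_sqrt_mul_wnorm_scaled hSpos hε]
        ring
      _ = _ := by rw [hsε, one_div_mul_cancel hε.ne', one_mul]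
  · rw [habs]
    calc 1 / ε * |I (xhat + (x - xhat)) - 1 / 2 * wnorm S (x - xhat) ^ 2|
        ≤ 1 / ε * (η * wnorm S (x - xhat) ^ 2) := by gcongr; exact hsq _
      _ = η * wnorm (ε • S) (x - xhat) ^ 2 := by
        rw [wnorm_scaled_sq S hε hSpos]
        ring
  · gcongr
  · set q := √ε * k * (6 / 5 * (2 * √2 * r)) with hq
    have hq0 : 0 ≤ q := by positivity
    -- Uses `q ≤ 1/20`. Together with the `12/5` in `q` the total factor is `96/19 < 2e`.
    have h1 : 2 * q / (1 - q) ≤ 40 / 19 * q := by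
      rw [div_le_iff₀ (by linarith)]
      nlinarith
    have h2 : constC d * √ε * (3 * k) = 2 * Real.exp 1 * (√ε * k * (√2 * r)) := by
      rw [constC]
      ring
    have h3 : q = 12 / 5 * (√ε * k * (√2 * r)) := by
      rw [hq]
      ring
    have h4 : 0 ≤ √ε * k * (√2 * r) := by positivity
    rw [h2]
    refine h1.trans ?_
    rw [h3]
    nlinarith [Real.exp_one_gt_d9]

/-! ### Boundedness along convergent families -/

lemma opNorm_matSqrt_sq {S : Matrix (Fin d) (Fin d) ℝ} (hS : S.PosDef) :
    opNorm (matSqrt S) ^ 2 = opNorm S := by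
  have h1 : IsSelfAdjoint (Matrix.toEuclideanCLM (𝕜 := ℝ) (matSqrt S)) :=
    (CFC.sqrt_nonneg S).isSelfAdjoint.map _
  rw [opNorm, opNorm, ← h1.norm_mul_self, ← map_mul, matSqrt,
    CFC.sqrt_mul_sqrt_self S hS.posSemidef.nonneg]

/-- From `‖S^{1/2}‖² = ‖S‖` and `a ≤ 1 + a²`; convergence of `S` then suffices, with no continuity
of the matrix square root. -/
lemma opNorm_mul_matSqrt_le (A : Matrix (Fin d) (Fin d) ℝ) {S : Matrix (Fin d) (Fin d) ℝ}
    (hS : S.PosDef) : opNorm (A * matSqrt S) ≤ opNorm A * (1 + opNorm S) := by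
  have h1 : opNorm (A * matSqrt S) ≤ opNorm A * opNorm (matSqrt S) := by
    rw [opNorm, map_mul]
    exact norm_mul_le _ _
  refine h1.trans ?_
  have := opNorm_nonneg A
  gcongr
  rw [← opNorm_matSqrt_sq hS]
  nlinarith [sq_nonneg (opNorm (matSqrt S) - 1 / 2)]

lemma continuous_opNorm : Continuous (opNorm : Matrix (Fin d) (Fin d) ℝ → ℝ) :=
  (LinearMap.continuous_of_finiteDimensional
    (Matrix.toEuclideanCLM (n := Fin d) (𝕜 := ℝ)).toAlgEquiv.toLinearMap).norm

lemma exists_bound_near_zero {f : ℝ → ℝ} {l : ℝ} (hf : Tendsto f (𝓝[>] 0) (𝓝 l)) :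
    ∃ δ > 0, ∃ b : ℝ, ∀ τ ∈ Icc 0 δ, f τ ≤ b := by
  have h1 : ∀ᶠ τ in 𝓝[>] (0 : ℝ), f τ < l + 1 := hf.eventually_lt_const (by linarith)
  obtain ⟨δ, hδ, h2⟩ := mem_nhdsGT_iff_exists_Ioc_subset.1 h1
  -- The limit only sees `τ > 0`, so the value at 0 enters separately.
  refine ⟨δ, hδ, max (l + 1) (f 0), fun τ hτ => ?_⟩
  rcases eq_or_lt_of_le hτ.1 with h | h
  · rw [← h]
    exact le_max_right _ _
  · exact (h2 ⟨h, hτ.2⟩ : f τ < l + 1).le.trans (le_max_left _ _)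

/-- At `τ = 0` the three quantities are 1, 0 and 0, so the inequalities are strict there and persist
by continuity. -/
lemma exists_small (p c₁ c₂ : ℝ) :
    ∃ δ > 0, ∀ τ ∈ Icc 0 δ, (1 - 2 * (τ * c₁)) ^ p ≤ 6 / 5 ∧ τ * c₁ < 1 / 2 ∧
      τ * c₂ ≤ 1 / 20 := by
  have t1 : Tendsto (fun τ : ℝ => (1 - 2 * (τ * c₁)) ^ p) (𝓝 0) (𝓝 1) := by
    have : ContinuousAt (fun τ : ℝ => (1 - 2 * (τ * c₁)) ^ p) 0 :=
      ContinuousAt.rpow_const (by fun_prop) (Or.inl (by simp))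
    simpa [ContinuousAt] using this
  have t2 : ∀ c : ℝ, Tendsto (fun τ : ℝ => τ * c) (𝓝 0) (𝓝 0) := fun c => by
    have : ContinuousAt (fun τ : ℝ => τ * c) 0 := by fun_prop
    simpa [ContinuousAt] using this
  have h := ((t1.eventually_lt_const (by norm_num : (1 : ℝ) < 6 / 5)).and
    (((t2 c₁).eventually_lt_const (by norm_num : (0 : ℝ) < 1 / 2)).and
      ((t2 c₂).eventually_lt_const (by norm_num : (0 : ℝ) < 1 / 20))))
  obtain ⟨δ, hδ, hb⟩ := Metric.eventually_nhds_iff.1 h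
  refine ⟨δ / 2, by positivity, fun τ hτ => ?_⟩
  have := hb (y := τ) (by
    rw [Real.dist_eq, sub_zero, abs_of_nonneg hτ.1]
    linarith [hτ.2])
  exact ⟨this.1.le, this.2.1, this.2.2.le⟩

end LaplaceApprox

end

/-! ### Uniform bounds for small `τ` and the main estimate -/

theorem theorem5p3 (d : ℕ) (hd : 0 < d) (ε : ℝ) (hε : 0 < ε)
    (A : Matrix (Fin d) (Fin d) ℝ) (F : Vec d → Vec d) (hF : ContDiff ℝ 3 F)
    (m₀ : Vec d) (S₀ : Matrix (Fin d) (Fin d) ℝ) (hS₀ : S₀.PosDef)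
    -- data, MAP estimates and covariances, indexed by `τ`
    (y xhat : ℝ → Vec d) (S : ℝ → Matrix (Fin d) (Fin d) ℝ)
    (τ₀ : ℝ) (hτ₀ : 0 < τ₀)
    (hmin : ∀ τ ∈ Icc 0 τ₀,
      IsUniqueMinimizer (perturbedPotential ε A F m₀ S₀ τ (y τ) (xhat τ)) (xhat τ))
    (hpos : ∀ τ ∈ Icc 0 τ₀,
      (hessian (perturbedPotential ε A F m₀ S₀ τ (y τ) (xhat τ)) (xhat τ)).PosDef)
    (hS : ∀ τ ∈ Icc 0 τ₀,
      S τ = (hessian (perturbedPotential ε A F m₀ S₀ τ (y τ) (xhat τ)) (xhat τ))⁻¹)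
    (ylim xlim : Vec d) (Slim : Matrix (Fin d) (Fin d) ℝ)
    (hylim : Tendsto y (𝓝[>] 0) (𝓝 ylim))
    (hxlim : Tendsto xhat (𝓝[>] 0) (𝓝 xlim))
    (hSlim : Tendsto S (𝓝[>] 0) (𝓝 Slim)) (hSlimpos : Slim.PosDef)
    (C₀ C₁ C₂ C₃ M : ℝ) (hC₀ : 0 < C₀) (hC₁ : 0 < C₁) (hC₂ : 0 < C₂) (hC₃ : 0 < C₃) (hM : 0 < M)
    (hF₀ : ∀ τ ∈ Icc 0 τ₀, ∀ x, diffNorm (S τ) 0 F x ≤ C₀)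
    (hF₁ : ∀ τ ∈ Icc 0 τ₀, ∀ x, diffNorm (S τ) 1 F x ≤ C₁)
    (hF₂ : ∀ τ ∈ Icc 0 τ₀, ∀ x, diffNorm (S τ) 2 F x ≤ C₂)
    (hF₃ : ∀ τ ∈ Icc 0 τ₀, ∀ x, diffNorm (S τ) 3 F x ≤ C₃)
    (hFM : ∀ x, x ∉ Metric.closedBall (0 : Vec d) M → iteratedFDeriv ℝ 3 F x = 0) :
    ∃ τ₁ : ℝ, 0 < τ₁ ∧ τ₁ ≤ τ₀ ∧
      (∀ τ ∈ Icc 0 τ₁,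
        tvDist (perturbedPosterior ε A F m₀ S₀ τ (y τ))
            (laplace ε (perturbedPotential ε A F m₀ S₀ τ (y τ) (xhat τ)) (xhat τ)) ≤
          constC d * (1 + ε) * √ε *
            (constV C₂ C₃ M A (S τ) (y τ) * τ + constW C₀ C₁ C₂ C₃ / 2 * τ ^ 2)) ∧
      Bornology.IsBounded ((fun τ => constV C₂ C₃ M A (S τ) (y τ)) '' Icc 0 τ₁) ∧
      ∃ L : ℝ, ∀ τ ∈ Icc 0 τ₁,
        tvDist (perturbedPosterior ε A F m₀ S₀ τ (y τ))
            (laplace ε (perturbedPotential ε A F m₀ S₀ τ (y τ) (xhat τ)) (xhat τ)) ≤ L * τ := by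
  have hSpos : ∀ τ ∈ Icc 0 τ₀, (S τ).PosDef := fun τ hτ => hS τ hτ ▸ (hpos τ hτ).inv
  obtain ⟨δ₁, hδ₁, b₁, hb₁⟩ := exists_bound_near_zero hylim.norm
  obtain ⟨δ₂, hδ₂, b₂, hb₂⟩ := exists_bound_near_zero hxlim.norm
  obtain ⟨δ₃, hδ₃, b₃, hb₃⟩ := exists_bound_near_zero ((continuous_opNorm.tendsto Slim).comp hSlim)
  have hA := opNorm_nonneg A
  have hW : 0 < constW C₀ C₁ C₂ C₃ := by unfold constW; positivity
  set W := constW C₀ C₁ C₂ C₃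
  set s := opNorm A * (1 + b₃) with hs
  set Vb := C₃ * (opNorm A * M + b₁) + 3 * C₂ * s with hVb
  set N := opNorm A * b₂ + b₁ + s with hN
  set r := Real.Gamma ((d : ℝ) / 2 + 3 / 2) / Real.Gamma ((d : ℝ) / 2) with hr
  have hr0 : 0 ≤ r := div_nonneg (Real.Gamma_nonneg_of_nonneg (by positivity))
    (Real.Gamma_nonneg_of_nonneg (by positivity))
  -- Both constants are uniform in `τ`: `Vb` and `N` bound the convergent families, and `τ ≤ τ₀` in
  -- the higher-order terms makes `η` and the moment bound linear in `τ`.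
  obtain ⟨δ₄, hδ₄, hb₄⟩ := exists_small (-((d : ℝ) + 3) / 2)
    (8 * (C₀ * N + τ₀ * C₀ ^ 2 / 2) + (Vb + W * τ₀) / 3)
    (√ε * ((Vb + W * τ₀) / 6) * (6 / 5 * (2 * √2 * r)))
  set τ₁ := min τ₀ (min (min δ₁ δ₂) (min δ₃ δ₄)) with hτ₁
  have hmem : ∀ τ ∈ Icc 0 τ₁, τ ∈ Icc 0 τ₀ ∧ τ ∈ Icc 0 δ₁ ∧ τ ∈ Icc 0 δ₂ ∧ τ ∈ Icc 0 δ₃ ∧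
      τ ∈ Icc 0 δ₄ := by
    rintro τ ⟨h0, h1⟩
    simp only [hτ₁, le_min_iff] at h1
    exact ⟨⟨h0, h1.1⟩, ⟨h0, h1.2.1.1⟩, ⟨h0, h1.2.1.2⟩, ⟨h0, h1.2.2.1⟩, ⟨h0, h1.2.2.2⟩⟩
  have hAS : ∀ τ ∈ Icc 0 τ₁, opNorm (A * matSqrt (S τ)) ≤ s := fun τ hτ => by
    obtain ⟨m0, -, -, m3, -⟩ := hmem τ hτ
    refine (opNorm_mul_matSqrt_le A (hSpos τ m0)).trans ?_
    rw [hs]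
    gcongr
    exact hb₃ τ m3
  have hV0 : ∀ τ, 0 ≤ constV C₂ C₃ M A (S τ) (y τ) := fun τ => by
    have := opNorm_nonneg (A * matSqrt (S τ))
    unfold constV
    positivity
  have hV : ∀ τ ∈ Icc 0 τ₁, constV C₂ C₃ M A (S τ) (y τ) ≤ Vb := fun τ hτ => by
    obtain ⟨-, m1, -⟩ := hmem τ hτ
    rw [constV, hVb]
    gcongr
    · exact hb₁ τ m1
    · exact hAS τ hτ
  have main : ∀ τ ∈ Icc 0 τ₁,
      tvDist (perturbedPosterior ε A F m₀ S₀ τ (y τ))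
          (laplace ε (perturbedPotential ε A F m₀ S₀ τ (y τ) (xhat τ)) (xhat τ)) ≤
        constC d * (1 + ε) * √ε *
          (constV C₂ C₃ M A (S τ) (y τ) * τ + W / 2 * τ ^ 2) := by
    intro τ hτ
    obtain ⟨m0, m1, m2, m3, m4⟩ := hmem τ hτ
    obtain ⟨e1, e2, e3⟩ := hb₄ τ m4
    have hτ0 : 0 ≤ τ := hτ.1
    have hV0τ := hV0 τ
    have hcube := abs_remainder_le_cube ε A hF m₀ hS₀ hτ0 (y τ) (xhat τ) (hmin τ m0) (hpos τ m0)
      (hS τ m0) hC₃.le hM.le (hF₀ τ m0) (hF₁ τ m0) (hF₂ τ m0) (hF₃ τ m0) hFM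
    set V := constV C₂ C₃ M A (S τ) (y τ)
    have hk : 0 ≤ (V * τ + W * τ ^ 2) / 6 := by positivity
    have hkle : (V * τ + W * τ ^ 2) / 6 ≤ τ * ((Vb + W * τ₀) / 6) := by
      have h1 : V * τ ≤ Vb * τ := mul_le_mul_of_nonneg_right (hV τ hτ) hτ0
      have h2 : W * τ ^ 2 ≤ W * (τ * τ₀) := by
        rw [sq]
        gcongr
        exact m0.2
      linarith
    have hsq := abs_remainder_le_sq ε A m₀ hS₀ hτ0 (y τ) (xhat τ) (hSpos τ m0) hk (hF₀ τ m0) hcube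
    have hηle : 8 * (τ * (C₀ * (opNorm A * ‖xhat τ‖ + ‖y τ‖ + opNorm (A * matSqrt (S τ))) +
        τ * C₀ ^ 2 / 2)) + 2 * ((V * τ + W * τ ^ 2) / 6) ≤
        τ * (8 * (C₀ * N + τ₀ * C₀ ^ 2 / 2) + (Vb + W * τ₀) / 3) := by
      have h1 : τ * (C₀ * (opNorm A * ‖xhat τ‖ + ‖y τ‖ + opNorm (A * matSqrt (S τ))) +
          τ * C₀ ^ 2 / 2) ≤ τ * (C₀ * N + τ₀ * C₀ ^ 2 / 2) := by
        rw [hN]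
        gcongr
        · exact hb₂ τ m2
        · exact hb₁ τ m1
        · exact hAS τ hτ
        · exact m0.2
      linarith
    refine (tvDist_posterior_laplace_le hd hε A hF m₀ hS₀ τ (y τ) (xhat τ) (hpos τ m0) (hS τ m0)
      hk e2 hcube (fun v => (hsq v).trans (by gcongr)) e1 (le_trans ?_ e3)).trans ?_
    · calc √ε * ((V * τ + W * τ ^ 2) / 6) * (6 / 5 * (2 * √2 * r))
          ≤ √ε * (τ * ((Vb + W * τ₀) / 6)) * (6 / 5 * (2 * √2 * r)) := by gcongr
        _ = _ := by ring
    · have hC := constC_nonneg d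
      -- The left side is `(Vτ + Wτ²)/2`; half of `Vτ`, and below the factor `1 + ε`, are given
      -- away.
      have h1 : 3 * ((V * τ + W * τ ^ 2) / 6) ≤ V * τ + W / 2 * τ ^ 2 := by
        nlinarith [mul_nonneg hV0τ hτ0]
      calc constC d * √ε * (3 * ((V * τ + W * τ ^ 2) / 6))
          ≤ constC d * √ε * (V * τ + W / 2 * τ ^ 2) := by gcongr
        _ = constC d * 1 * √ε * (V * τ + W / 2 * τ ^ 2) := by ring
        _ ≤ constC d * (1 + ε) * √ε * (V * τ + W / 2 * τ ^ 2) := by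
          gcongr
          linarith
  -- `L` comes from `V ≤ Vb` and `τ² ≤ τ₀τ`.
  refine ⟨τ₁, by positivity, min_le_left _ _, main, ?_,
    constC d * (1 + ε) * √ε * (Vb + W / 2 * τ₀), fun τ hτ => (main τ hτ).trans ?_⟩
  · refine (Metric.isBounded_Icc 0 Vb).subset ?_
    rintro _ ⟨τ, hτ, rfl⟩
    exact ⟨hV0 τ, hV τ hτ⟩
  · have hC := constC_nonneg d
    obtain ⟨m0, -⟩ := hmem τ hτ
    have hτ0 : 0 ≤ τ := hτ.1
    rw [mul_assoc _ _ τ]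
    gcongr
    have h1 : constV C₂ C₃ M A (S τ) (y τ) * τ ≤ Vb * τ :=
      mul_le_mul_of_nonneg_right (hV τ hτ) hτ0
    have h2 : W / 2 * τ ^ 2 ≤ W / 2 * (τ * τ₀) := by
      rw [sq]
      gcongr
      exact m0.2
    linarith
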